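/- **Theorem.** Let $n\ge 0$ be an integer and let $p$ be a polynomial with real coefficients, of degree $2n$, having no zeros on the unit circle $|z|=1$. Let $g$ be a continuous function on the unit circle with $$g(z)^2=\frac{p(z)}{z^{2n}\,p(1/z)},\qquad |z|=1,$$ i.e. a continuous branch of $\sqrt{p(z)/(z^{2n}p(1/z))}$ there. For $\lambda\in\mathbb{C}\setminus\{1,-1\}$ put $$\Phi(z)=\begin{pmatrix} i\lambda & g(z)\\ -g(z)^{-1} & i\lambda\end{pmatrix},\qquad \beta(\lambda)=\frac1{2\pi i}\log\frac{\lambda+1}{\lambda-1},$$ with the principal logarithm. If $\beta(\lambda)$ is purely imaginary (equivalently, $\lambda$ is real with $|\lambda|>1$), then the Riemann–Hilbert problem $$T_+(z)=\Phi(z)\,T_-(z),\quad |z|=1,\qquad T_-(\infty)=I,$$ is solvable: there exist $2\times2$ matrix-valued functions $T_+$, holomorphic in $|z|<1$ and continuous on $|z|\le 1$, and $T_-$, holomorphic in $|z|>1$ and continuous on $|z|\ge 1$, such that $T_+(z)=\Phi(z)T_-(z)$ for $|z|=1$ and $T_-(z)\to I$ as $z\to\infty$. -/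

import Mathlib

open Complex Filter Topology

noncomputable section

/-- `β(λ) = (1 / (2πi)) log ((λ + 1) / (λ - 1))`, for `λ ≠ ±1`. -/
def beta (lam : ℂ) : ℂ :=
  1 / (2 * (Real.pi : ℂ) * I) * Complex.log ((lam + 1) / (lam - 1))

/-- `g` is, on the unit circle, a continuous branch of
`√(p(z) / (z ^ (2n) p(1/z)))`. Only the values of `g` on the unit circle matter. -/
structure IsSymbolBranch (n : ℕ) (p : Polynomial ℝ) (g : ℂ → ℂ) : Prop where
  continuousOn : ContinuousOn g {z : ℂ | ‖z‖ = 1}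
  sq_eq : ∀ z : ℂ, ‖z‖ = 1 →
    g z ^ 2 = Polynomial.aeval z p / (z ^ (2 * n) * Polynomial.aeval (1 / z) p)

/-- The matrix symbol `Φ(z)` with parameter `λ`. -/
def Phi (lam : ℂ) (g : ℂ → ℂ) (z : ℂ) : Matrix (Fin 2) (Fin 2) ℂ :=
  !![I * lam, g z; -(g z)⁻¹, I * lam]

/-- `(Tp, Tm)` solves the Riemann–Hilbert problem `T₊ = Φ T₋` on the unit circle:
`T₊` is holomorphic inside and `T₋` outside the circle, both are continuous up to the
circle (so that their values there are the boundary values), and `T₋(∞) = I`. -/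
structure IsRHSolution (Φ Tp Tm : ℂ → Matrix (Fin 2) (Fin 2) ℂ) : Prop where
  holo_inside : ∀ i j, DifferentiableOn ℂ (fun z => Tp z i j) {z : ℂ | ‖z‖ < 1}
  holo_outside : ∀ i j, DifferentiableOn ℂ (fun z => Tm z i j) {z : ℂ | 1 < ‖z‖}
  cont_inside : ContinuousOn Tp {z : ℂ | ‖z‖ ≤ 1}
  cont_outside : ContinuousOn Tm {z : ℂ | 1 ≤ ‖z‖}
  jump : ∀ z : ℂ, ‖z‖ = 1 → Tp z = Φ z * Tm z
  at_infinity : Tendsto Tm (cocompact ℂ) (𝓝 1)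

end

/-! Since `p` is real, `p(1/z)` is the conjugate of `p(z)` on the circle, so `|g| = 1` there. Put `μ
= iλ`; the condition on `β` forces `|μ| > 1`. A column `(V₁, V₂)` of `T₋` with value `(c₁, c₂)` at
infinity must have no positive frequencies, and `Φ (V₁, V₂)` must have no negative ones. With `P`
the orthogonal projection of `L²` onto negative frequencies, this reads `V₁ = c₁ - μ⁻¹ P(g V₂)`, `V₂
= c₂ - μ⁻¹ P(-g⁻¹ V₁)`. As `P` and both multiplications have norm at most 1, the right side is a
contraction of ratio `1/|μ|` (`exists_fixedPoint`).

Continuity up to the circle comes from regularity: `g` is Lipschitz and `P` commutes with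
translations, so the same contraction estimate makes the fixed point Lipschitz under translations in
`L²` (`translationLipschitz_of_fixedPoint`). Its Fourier coefficients are then absolutely summable
(`TranslationLipschitz.summable_norm_fourierCoeff`), and `T₊`, `T₋` are power series in `z` and
`1/z` converging absolutely up to the circle. -/

noncomputable section

open MeasureTheory AddCircle

/-! ### Fourier coefficients and multiplication on `L²` of the circle -/

/-- The Hilbert space `L²` of the unit additive circle. -/
abbrev CircleL2 : Type := Lp ℂ 2 (haarAddCircle : Measure UnitAddCircle)

namespace CircleL2

lemma inner_fourierLp (f : CircleL2) (k : ℤ) :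
    inner ℂ (fourierLp 2 k : CircleL2) f = fourierCoeff f k := by
  rw [← fourierBasis_repr, HilbertBasis.repr_apply_apply, coe_fourierBasis]

lemma ext_fourierCoeff {f g : CircleL2} (h : ∀ k, fourierCoeff f k = fourierCoeff g k) :
    f = g := by
  apply fourierBasis.repr.injective
  ext k
  rw [fourierBasis_repr, fourierBasis_repr, h]

lemma fourierCoeff_add (f g : CircleL2) (k : ℤ) :
    fourierCoeff (f + g : CircleL2) k = fourierCoeff f k + fourierCoeff g k := by
  simp only [← inner_fourierLp, inner_add_right]

lemma fourierCoeff_sub (f g : CircleL2) (k : ℤ) :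
    fourierCoeff (f - g : CircleL2) k = fourierCoeff f k - fourierCoeff g k := by
  simp only [← inner_fourierLp, inner_sub_right]

lemma fourierCoeff_smul (c : ℂ) (f : CircleL2) (k : ℤ) :
    fourierCoeff (c • f : CircleL2) k = c * fourierCoeff f k := by
  simp only [← inner_fourierLp, inner_smul_right]

lemma fourierCoeff_fourierLp (j k : ℤ) :
    fourierCoeff (fourierLp 2 j : CircleL2) k = if k = j then 1 else 0 := by
  rw [← inner_fourierLp]
  exact orthonormal_iff_ite.1 orthonormal_fourier k j

lemma hasSum_sq_fourierCoeff_norm (f : CircleL2) :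
    HasSum (fun k => ‖fourierCoeff f k‖ ^ 2) (‖f‖ ^ 2) := by
  have H : HasSum (fun i => ‖fourierBasis.repr f i‖ ^ 2) (‖fourierBasis.repr f‖ ^ 2) := by
    apply_mod_cast lp.hasSum_norm ?_ (fourierBasis.repr f)
    simp
  simpa only [fourierBasis_repr, LinearIsometryEquiv.norm_map] using H

lemma memLp_mul (G : C(UnitAddCircle, ℂ)) (f : CircleL2) :
    MemLp (fun x => G x * f x) 2 haarAddCircle :=
  MemLp.of_le_mul (c := ‖G‖) (Lp.memLp f)
    ((map_continuous G).aestronglyMeasurable.mul (Lp.aestronglyMeasurable f))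
    (ae_of_all _ fun x => by
      rw [norm_mul]; gcongr; exact G.norm_coe_le_norm x)

/-- Multiplication of an `L²` function by a continuous function. -/
def mulCont (G : C(UnitAddCircle, ℂ)) : CircleL2 →ₗ[ℂ] CircleL2 where
  toFun f := (memLp_mul G f).toLp
  map_add' f g := by
    rw [← MemLp.toLp_add]
    apply MemLp.toLp_congr
    filter_upwards [Lp.coeFn_add f g] with x hx
    simp only [Pi.add_apply] at hx ⊢
    rw [hx, mul_add]
  map_smul' c f := by
    rw [RingHom.id_apply, ← MemLp.toLp_const_smul]
    apply MemLp.toLp_congr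
    filter_upwards [Lp.coeFn_smul c f] with x hx
    simp only [Pi.smul_apply, smul_eq_mul] at hx ⊢
    rw [hx, mul_left_comm]

lemma coeFn_mulCont (G : C(UnitAddCircle, ℂ)) (f : CircleL2) :
    mulCont G f =ᵐ[haarAddCircle] fun x => G x * f x :=
  (memLp_mul G f).coeFn_toLp

lemma mulCont_sub_left (G H : C(UnitAddCircle, ℂ)) (f : CircleL2) :
    mulCont (G - H) f = mulCont G f - mulCont H f := by
  apply Lp.ext
  filter_upwards [coeFn_mulCont (G - H) f, coeFn_mulCont G f, coeFn_mulCont H f,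
    Lp.coeFn_sub (mulCont G f) (mulCont H f)] with x h1 h2 h3 h4
  rw [h1, h4, Pi.sub_apply, h2, h3, ContinuousMap.sub_apply, sub_mul]

lemma norm_mulCont_le {G : C(UnitAddCircle, ℂ)} {C : ℝ} (hG : ∀ x, ‖G x‖ ≤ C) (f : CircleL2) :
    ‖mulCont G f‖ ≤ C * ‖f‖ := by
  apply Lp.norm_le_mul_norm_of_ae_le_mul
  filter_upwards [coeFn_mulCont G f] with x h1
  rw [h1, norm_mul]
  gcongr
  exact hG x

/-! ### Translations -/

/-- Translation of `L²` functions. -/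
def translate (h : UnitAddCircle) : CircleL2 →ₗᵢ[ℂ] CircleL2 :=
  Lp.compMeasurePreservingₗᵢ ℂ (· + h) (measurePreserving_add_right haarAddCircle h)

lemma coeFn_translate (h : UnitAddCircle) (f : CircleL2) :
    translate h f =ᵐ[haarAddCircle] fun x => f (x + h) :=
  Lp.coeFn_compMeasurePreserving f (measurePreserving_add_right haarAddCircle h)

/-- Translation of continuous functions. -/
def translateCont (h : UnitAddCircle) (G : C(UnitAddCircle, ℂ)) : C(UnitAddCircle, ℂ) :=
  ⟨fun x => G (x + h), by fun_prop⟩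

lemma translate_mulCont (h : UnitAddCircle) (G : C(UnitAddCircle, ℂ)) (f : CircleL2) :
    translate h (mulCont G f) = mulCont (translateCont h G) (translate h f) := by
  apply Lp.ext
  filter_upwards [coeFn_translate h (mulCont G f), coeFn_mulCont (translateCont h G) (translate h f),
    coeFn_translate h f,
    (measurePreserving_add_right haarAddCircle h).quasiMeasurePreserving.ae
      (coeFn_mulCont G f)] with x h1 h2 h3 h4
  rw [h1, h4, h2, h3]
  rfl

lemma fourierCoeff_translate (h : UnitAddCircle) (f : CircleL2) (k : ℤ) :
    fourierCoeff (translate h f) k = fourier k h * fourierCoeff f k := by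
  rw [fourierCoeff_congr_ae (coeFn_translate h f), fourierCoeff, fourierCoeff,
    ← integral_const_mul,
    ← integral_add_right_eq_self (fun x => fourier k h * (fourier (-k) x • f x)) h]
  congr 1
  ext x
  have h1 : (fourier (-k) x : ℂ) = fourier k h * fourier (-k) (x + h) := by
    simp only [fourier_apply, ← Circle.coe_mul, ← toCircle_add]
    congr 2
    module
  rw [smul_eq_mul, smul_eq_mul, h1, mul_assoc]

/-! ### Projection onto negative frequencies -/

/-- The `L²` functions with spectrum in the negative integers. -/
def negSpectrum : Submodule ℂ CircleL2 :=
  (Submodule.span ℂ (Set.range fun k : ℕ => (fourierLp 2 (k : ℤ) : CircleL2)))ᗮ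

instance : negSpectrum.HasOrthogonalProjection := by
  unfold negSpectrum; infer_instance

lemma mem_negSpectrum {f : CircleL2} :
    f ∈ negSpectrum ↔ ∀ k : ℤ, 0 ≤ k → fourierCoeff f k = 0 := by
  rw [negSpectrum, Submodule.mem_orthogonal]
  constructor
  · intro h k hk
    rw [← inner_fourierLp]
    lift k to ℕ using hk
    exact h _ (Submodule.subset_span ⟨k, rfl⟩)
  · intro h u hu
    induction hu using Submodule.span_induction with
    | mem x hx =>
      obtain ⟨k, rfl⟩ := hx
      rw [inner_fourierLp]
      exact h k (by positivity)
    | zero => simp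
    | add x y _ _ hx hy => rw [inner_add_left, hx, hy, add_zero]
    | smul a x _ hx => rw [inner_smul_left, hx, mul_zero]

/-- The orthogonal projection onto the functions with negative spectrum. -/
def projNeg : CircleL2 →L[ℂ] CircleL2 := negSpectrum.starProjection

lemma norm_projNeg_le (f : CircleL2) : ‖projNeg f‖ ≤ ‖f‖ :=
  negSpectrum.norm_starProjection_apply_le f

lemma fourierCoeff_projNeg (f : CircleL2) (k : ℤ) :
    fourierCoeff (projNeg f) k = if k < 0 then fourierCoeff f k else 0 := by
  split_ifs with hk
  · have h1 := negSpectrum.starProjection_inner_eq_zero f (fourierLp 2 k) (by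
      rw [mem_negSpectrum]
      intro j hj
      rw [fourierCoeff_fourierLp, if_neg (by omega)])
    rw [← inner_conj_symm, inner_fourierLp, map_eq_zero, fourierCoeff_sub, sub_eq_zero] at h1
    exact h1.symm
  · exact mem_negSpectrum.1 (negSpectrum.starProjection_apply_mem f) k (by omega)

/-- Both operators are diagonal in the Fourier basis. -/
lemma translate_projNeg (h : UnitAddCircle) (f : CircleL2) :
    translate h (projNeg f) = projNeg (translate h f) := by
  apply ext_fourierCoeff
  intro k
  simp only [fourierCoeff_translate, fourierCoeff_projNeg]
  split_ifs <;> simp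

/-! ### From translation regularity to absolutely convergent Fourier series -/

/-- `f` is Lipschitz under small positive translations, in the `L²` sense. -/
def TranslationLipschitz (f : CircleL2) : Prop :=
  ∃ C δ : ℝ, 0 < δ ∧ ∀ h : ℝ, 0 < h → h < δ → ‖translate (h : UnitAddCircle) f - f‖ ≤ C * h

/-- `|exp(iθ) - 1| = 2 |sin(θ/2)|`, combined with Jordan's inequality `|sin x| ≥ 2|x|/π` for `|x| ≤
π/2`. -/
lemma four_mul_le_norm_fourier_sub_one {h : ℝ} {k : ℤ} (hk : |k * h| ≤ 1 / 2) :
    4 * |k * h| ≤ ‖fourier k (h : UnitAddCircle) - 1‖ := by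
  have e : (fourier k (h : UnitAddCircle) : ℂ) = exp (I * ((2 * Real.pi * (k * h) : ℝ) : ℂ)) := by
    rw [fourier_coe_apply]
    congr 1
    push_cast
    ring
  rw [e, Complex.norm_exp_I_mul_ofReal_sub_one, norm_mul, Real.norm_eq_abs, Real.norm_eq_abs]
  have h2 : 2 * Real.pi * (k * h) / 2 = Real.pi * (k * h) := by ring
  have hpi := Real.pi_pos
  have h3 := Real.mul_abs_le_abs_sin (x := Real.pi * (k * h)) (by
    rw [abs_mul, abs_of_pos hpi]; nlinarith)
  rw [abs_mul, abs_of_pos hpi] at h3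
  have h4 : 2 / Real.pi * (Real.pi * |k * h|) = 2 * |k * h| := by field_simp
  rw [h2, abs_two]
  linarith

/-- Parseval applied to `translate h f - f` bounds every finite partial sum of `k² |f_k|²` by
`C²/16`. Then `|f_k| = (|k| |f_k|) (1/|k|)` is dominated by a sum of squares. -/
lemma TranslationLipschitz.summable_norm_fourierCoeff {f : CircleL2}
    (hf : TranslationLipschitz f) : Summable fun k : ℤ => ‖fourierCoeff f k‖ := by
  obtain ⟨C, δ, hδ, hC⟩ := hf
  have hsq : Summable fun k : ℤ => (k : ℝ) ^ 2 * ‖fourierCoeff f k‖ ^ 2 := by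
    apply summable_of_sum_le (c := C ^ 2 / 16) (fun k => by positivity)
    intro s
    set K : ℝ := ∑ k ∈ s, |(k : ℝ)| with hK
    have hK0 : 0 ≤ K := Finset.sum_nonneg fun k _ => abs_nonneg _
    -- Small enough that `h < δ` and `|k h| ≤ 1/2` for all `k ∈ s`, as `K` bounds each such `|k|`.
    set h : ℝ := min (δ / 2) (1 / (2 * (K + 1))) with hh
    have h0 : 0 < h := by positivity
    have hle : h * (2 * (K + 1)) ≤ 1 := by
      rw [← le_div_iff₀ (by positivity)]; exact min_le_right _ _
    have hCh := hC h h0 ((min_le_left _ _).trans_lt (by linarith))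
    have hterm : ∀ k ∈ s, 16 * h ^ 2 * ((k : ℝ) ^ 2 * ‖fourierCoeff f k‖ ^ 2) ≤
        ‖fourierCoeff (translate (h : UnitAddCircle) f - f : CircleL2) k‖ ^ 2 := by
      intro k hk
      have hkK : |(k : ℝ)| ≤ K :=
        Finset.single_le_sum (f := fun k : ℤ => |(k : ℝ)|) (fun k _ => abs_nonneg _) hk
      have h1 := four_mul_le_norm_fourier_sub_one (h := h) (k := k) (by
        rw [abs_mul, abs_of_pos h0]; nlinarith)
      rw [fourierCoeff_sub, fourierCoeff_translate, ← sub_one_mul, norm_mul, mul_pow]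
      have h2 : 16 * h ^ 2 * ((k : ℝ) ^ 2 * ‖fourierCoeff f k‖ ^ 2) =
          (4 * |k * h|) ^ 2 * ‖fourierCoeff f k‖ ^ 2 := by
        rw [mul_pow, sq_abs]; ring
      rw [h2]
      gcongr
    have hsum : 16 * h ^ 2 * ∑ k ∈ s, (k : ℝ) ^ 2 * ‖fourierCoeff f k‖ ^ 2 ≤ (C * h) ^ 2 := by
      rw [Finset.mul_sum]
      refine (Finset.sum_le_sum hterm).trans ?_
      refine (sum_le_hasSum s (fun k _ => by positivity)
        (hasSum_sq_fourierCoeff_norm (translate (h : UnitAddCircle) f - f))).trans ?_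
      gcongr
    have hh2 : 0 < h ^ 2 := by positivity
    rw [le_div_iff₀ (by norm_num)]
    nlinarith
  have hinv : Summable fun k : ℤ => 1 / (k : ℝ) ^ 2 :=
    Real.summable_one_div_int_pow.2 one_lt_two
  -- The weight `k²` loses the frequency `0`, which is added back separately.
  have hfin : Summable fun k : ℤ => if k = 0 then ‖fourierCoeff f 0‖ else 0 :=
    summable_of_hasFiniteSupport ((Set.finite_singleton (0 : ℤ)).subset fun k hk => by
      by_contra h0; simp_all)
  refine Summable.of_nonneg_of_le (fun k => norm_nonneg _) (fun k => ?_)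
    ((hsq.add hinv).add hfin)
  by_cases hk : k = 0
  · simp [hk]
  · have hk' : (k : ℝ) ≠ 0 := by exact_mod_cast hk
    have h1 : ‖fourierCoeff f k‖ = (|(k : ℝ)| * ‖fourierCoeff f k‖) * (1 / |(k : ℝ)|) := by
      field_simp
    have h2 : (|(k : ℝ)| * ‖fourierCoeff f k‖) ^ 2 = (k : ℝ) ^ 2 * ‖fourierCoeff f k‖ ^ 2 := by
      rw [mul_pow, sq_abs]
    have h3 : (1 / |(k : ℝ)|) ^ 2 = 1 / (k : ℝ) ^ 2 := by rw [div_pow, sq_abs, one_pow]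
    have h4 : 0 ≤ (|(k : ℝ)| * ‖fourierCoeff f k‖) * (1 / |(k : ℝ)|) := by positivity
    rw [if_neg hk, ← h2, ← h3]
    nlinarith [two_mul_le_add_sq (|(k : ℝ)| * ‖fourierCoeff f k‖) (1 / |(k : ℝ)|)]

/-- The series converges uniformly, hence in `L²`, where its sum is already known to be `f`. -/
lemma coeFn_eq_tsum_fourier {f : CircleL2} (hf : Summable fun k : ℤ => ‖fourierCoeff f k‖) :
    f =ᵐ[haarAddCircle] fun x => ∑' k : ℤ, fourierCoeff f k * fourier k x := by
  have hs : Summable fun k : ℤ => fourierCoeff f k • (fourier k : C(UnitAddCircle, ℂ)) := by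
    apply Summable.of_norm
    simpa only [norm_smul, fourier_norm, mul_one] using hf
  have h1 := (ContinuousMap.toLp (E := ℂ) 2 (haarAddCircle : Measure UnitAddCircle) ℂ).hasSum
    hs.hasSum
  have h2 : f = ContinuousMap.toLp (E := ℂ) 2 haarAddCircle ℂ
      (∑' k : ℤ, fourierCoeff f k • (fourier k : C(UnitAddCircle, ℂ))) := by
    refine (hasSum_fourier_series_L2 f).unique ?_
    simpa only [Function.comp_def, map_smul] using h1
  have h3 := ContinuousMap.coeFn_toLp (p := 2) (𝕜 := ℂ) (haarAddCircle : Measure UnitAddCircle)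
    (∑' k : ℤ, fourierCoeff f k • (fourier k : C(UnitAddCircle, ℂ)))
  rw [← h2] at h3
  filter_upwards [h3] with x hx
  rw [hx, ← ContinuousMap.tsum_apply hs x]
  rfl

end CircleL2

/-! ### Power series on the closed disc -/

/-- The sum of the power series with coefficients `a`. -/
def powerSum (a : ℕ → ℂ) (z : ℂ) : ℂ := ∑' k, a k * z ^ k

lemma norm_mul_pow_le_of_norm_le_one (a : ℕ → ℂ) (k : ℕ) {z : ℂ} (hz : ‖z‖ ≤ 1) :
    ‖a k * z ^ k‖ ≤ ‖a k‖ := by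
  rw [norm_mul, norm_pow]
  exact mul_le_of_le_one_right (norm_nonneg _) (pow_le_one₀ (norm_nonneg _) hz)

lemma continuousOn_powerSum {a : ℕ → ℂ} (ha : Summable fun k => ‖a k‖) :
    ContinuousOn (powerSum a) {z | ‖z‖ ≤ 1} :=
  continuousOn_tsum (fun k => by fun_prop) ha
    fun k _ hz => norm_mul_pow_le_of_norm_le_one a k hz

lemma differentiableOn_powerSum {a : ℕ → ℂ} (ha : Summable fun k => ‖a k‖) :
    DifferentiableOn ℂ (powerSum a) {z | ‖z‖ < 1} :=
  differentiableOn_tsum_of_summable_norm ha (fun k => by fun_prop)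
    (isOpen_lt continuous_norm continuous_const)
    fun k _ hz => norm_mul_pow_le_of_norm_le_one a k (le_of_lt hz)

lemma powerSum_zero (a : ℕ → ℂ) : powerSum a 0 = a 0 := by
  rw [powerSum, tsum_eq_single 0 (fun k hk => by simp [hk])]
  simp

/-! ### The fixed point and its regularity -/

namespace CircleL2

lemma exists_fixedPoint {μ : ℂ} (hμ : 1 < ‖μ‖) {G₁ G₂ : C(UnitAddCircle, ℂ)}
    (h₁ : ∀ x, ‖G₁ x‖ ≤ 1) (h₂ : ∀ x, ‖G₂ x‖ ≤ 1) (F₁ F₂ : CircleL2) :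
    ∃ V₁ V₂ : CircleL2, V₁ = F₁ - μ⁻¹ • projNeg (mulCont G₁ V₂) ∧
      V₂ = F₂ - μ⁻¹ • projNeg (mulCont G₂ V₁) := by
  have key : ∀ (G : C(UnitAddCircle, ℂ)) (F U V : CircleL2), (∀ x, ‖G x‖ ≤ 1) →
      dist (F - μ⁻¹ • projNeg (mulCont G U)) (F - μ⁻¹ • projNeg (mulCont G V)) ≤
        ‖μ‖⁻¹ * dist U V := by
    intro G F U V hG
    rw [dist_sub_left, dist_eq_norm, dist_eq_norm, ← smul_sub, ← map_sub, ← map_sub, norm_smul,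
      norm_inv]
    gcongr
    exact (norm_projNeg_le _).trans ((norm_mulCont_le hG _).trans (one_mul _).le)
  let T : CircleL2 × CircleL2 → CircleL2 × CircleL2 := fun V =>
    (F₁ - μ⁻¹ • projNeg (mulCont G₁ V.2), F₂ - μ⁻¹ • projNeg (mulCont G₂ V.1))
  have hT : ContractingWith ‖μ‖₊⁻¹ T := by
    refine ⟨inv_lt_one_of_one_lt₀ (by exact_mod_cast hμ), LipschitzWith.of_dist_le_mul ?_⟩
    intro U V
    rw [Prod.dist_eq, NNReal.coe_inv, coe_nnnorm]
    apply max_le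
    · refine (key G₁ F₁ U.2 V.2 h₁).trans ?_
      gcongr
      exact le_max_right _ _
    · refine (key G₂ F₂ U.1 V.1 h₂).trans ?_
      gcongr
      exact le_max_left _ _
  have hfix : T (hT.fixedPoint T) = hT.fixedPoint T := hT.fixedPoint_isFixedPt
  exact ⟨(hT.fixedPoint T).1, (hT.fixedPoint T).2, congrArg Prod.fst hfix.symm,
    congrArg Prod.snd hfix.symm⟩

/-- `G` is uniformly Lipschitz under small positive translations. -/
def UniformTranslationLipschitz (G : C(UnitAddCircle, ℂ)) : Prop :=
  ∃ C δ : ℝ, 0 < δ ∧ ∀ h : ℝ, 0 < h → h < δ → ∀ x, ‖G (x + (h : UnitAddCircle)) - G x‖ ≤ C * h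

/-- A discrete product rule. The factor 1 on `‖translate h f - f‖` is what later allows absorption
by `‖μ‖ > 1`. -/
lemma norm_translate_mulCont_sub_le {G : C(UnitAddCircle, ℂ)} (hG : ∀ x, ‖G x‖ ≤ 1)
    {h : UnitAddCircle} {C : ℝ} (hC : ∀ x, ‖G (x + h) - G x‖ ≤ C) (f : CircleL2) :
    ‖translate h (mulCont G f) - mulCont G f‖ ≤ ‖translate h f - f‖ + C * ‖f‖ := by
  have hd : ∀ x, ‖(translateCont h G - G) x‖ ≤ C := hC
  have hg : ∀ x, ‖translateCont h G x‖ ≤ 1 := fun x => hG (x + h)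
  have e : translate h (mulCont G f) - mulCont G f =
      mulCont (translateCont h G) (translate h f - f) + mulCont (translateCont h G - G) f := by
    rw [translate_mulCont, mulCont_sub_left, map_sub]
    abel
  rw [e]
  refine (norm_add_le _ _).trans (add_le_add ?_ (norm_mulCont_le hd f))
  exact (norm_mulCont_le hg _).trans (one_mul _).le

lemma UniformTranslationLipschitz.translationLipschitz_mulCont {G : C(UnitAddCircle, ℂ)}
    (hL : UniformTranslationLipschitz G) (hG : ∀ x, ‖G x‖ ≤ 1) {f : CircleL2}
    (hf : TranslationLipschitz f) : TranslationLipschitz (mulCont G f) := by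
  obtain ⟨C, δ, hδ, hC⟩ := hL
  obtain ⟨D, ε, hε, hD⟩ := hf
  refine ⟨D + C * ‖f‖, min δ ε, lt_min hδ hε, fun h h0 hh => ?_⟩
  have h1 := norm_translate_mulCont_sub_le hG (hC h h0 (hh.trans_le (min_le_left _ _))) f
  have h2 := hD h h0 (hh.trans_le (min_le_right _ _))
  linarith

lemma TranslationLipschitz.add {f g : CircleL2} (hf : TranslationLipschitz f)
    (hg : TranslationLipschitz g) : TranslationLipschitz (f + g) := by
  obtain ⟨C, δ, hδ, hC⟩ := hf
  obtain ⟨D, ε, hε, hD⟩ := hg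
  refine ⟨C + D, min δ ε, lt_min hδ hε, fun h h0 hh => ?_⟩
  have h1 := hC h h0 (hh.trans_le (min_le_left _ _))
  have h2 := hD h h0 (hh.trans_le (min_le_right _ _))
  rw [map_add, add_sub_add_comm, add_mul]
  exact (norm_add_le _ _).trans (add_le_add h1 h2)

lemma TranslationLipschitz.smul {f : CircleL2} (hf : TranslationLipschitz f) (c : ℂ) :
    TranslationLipschitz (c • f) := by
  obtain ⟨C, δ, hδ, hC⟩ := hf
  refine ⟨‖c‖ * C, δ, hδ, fun h h0 hh => ?_⟩
  rw [map_smul, ← smul_sub, norm_smul, mul_assoc]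
  gcongr
  exact hC h h0 hh

lemma translate_fourierLp_zero (h : UnitAddCircle) :
    translate h (fourierLp 2 0 : CircleL2) = fourierLp 2 0 := by
  apply ext_fourierCoeff
  intro k
  rw [fourierCoeff_translate, fourierCoeff_fourierLp]
  split_ifs with hk
  · rw [hk, _root_.fourier_zero, one_mul]
  · rw [mul_zero]

/-- Differencing the equations kills the constants and gives `‖μ‖ d₁ ≤ d₂ + O(h)` and `‖μ‖ d₂ ≤ d₁ +
O(h)`, where `dᵢ = ‖translate h Vᵢ - Vᵢ‖`. Adding them and absorbing leaves `(‖μ‖ - 1)(d₁ + d₂) =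
O(h)`. -/
lemma translationLipschitz_of_fixedPoint {μ : ℂ} (hμ : 1 < ‖μ‖) {G₁ G₂ : C(UnitAddCircle, ℂ)}
    (h₁ : ∀ x, ‖G₁ x‖ ≤ 1) (h₂ : ∀ x, ‖G₂ x‖ ≤ 1) (hL₁ : UniformTranslationLipschitz G₁)
    (hL₂ : UniformTranslationLipschitz G₂) {c₁ c₂ : ℂ} {V₁ V₂ : CircleL2}
    (hV₁ : V₁ = c₁ • fourierLp 2 0 - μ⁻¹ • projNeg (mulCont G₁ V₂))
    (hV₂ : V₂ = c₂ • fourierLp 2 0 - μ⁻¹ • projNeg (mulCont G₂ V₁)) :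
    TranslationLipschitz V₁ ∧ TranslationLipschitz V₂ := by
  have key : ∀ {c : ℂ} {G : C(UnitAddCircle, ℂ)} {U V : CircleL2} {h : UnitAddCircle} {C : ℝ},
      (∀ x, ‖G x‖ ≤ 1) → (∀ x, ‖G (x + h) - G x‖ ≤ C) →
      U = c • fourierLp 2 0 - μ⁻¹ • projNeg (mulCont G V) →
      ‖μ‖ * ‖translate h U - U‖ ≤ ‖translate h V - V‖ + C * ‖V‖ := by
    intro c G U V h C hG hC hU
    have e : translate h U - U =
        -(μ⁻¹ • projNeg (translate h (mulCont G V) - mulCont G V)) := by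
      rw [hU, map_sub, map_smul, map_smul, translate_fourierLp_zero, translate_projNeg, map_sub,
        smul_sub]
      abel
    rw [e, norm_neg, norm_smul, norm_inv, mul_inv_cancel_left₀ (by positivity)]
    exact (norm_projNeg_le _).trans (norm_translate_mulCont_sub_le hG hC V)
  obtain ⟨C, δ, hδ, hC⟩ := hL₁
  obtain ⟨D, ε, hε, hD⟩ := hL₂
  have main : ∀ h : ℝ, 0 < h → h < min δ ε →
      ‖translate (h : UnitAddCircle) V₁ - V₁‖ + ‖translate (h : UnitAddCircle) V₂ - V₂‖ ≤
        (C * ‖V₂‖ + D * ‖V₁‖) / (‖μ‖ - 1) * h := by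
    intro h h0 hh
    have k1 := key h₁ (hC h h0 (hh.trans_le (min_le_left _ _))) hV₁
    have k2 := key h₂ (hD h h0 (hh.trans_le (min_le_right _ _))) hV₂
    rw [div_mul_eq_mul_div, le_div_iff₀ (by linarith)]
    linarith
  exact ⟨⟨_, _, lt_min hδ hε, fun h h0 hh =>
      (le_add_of_nonneg_right (norm_nonneg _)).trans (main h h0 hh)⟩,
    ⟨_, _, lt_min hδ hε, fun h h0 hh =>
      (le_add_of_nonneg_left (norm_nonneg _)).trans (main h h0 hh)⟩⟩

/-! ### From `L²` equations to pointwise jump relations -/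

lemma coeFn_eq_powerSum {f : CircleL2} (hf : Summable fun k : ℤ => ‖fourierCoeff f k‖)
    (h0 : ∀ k : ℤ, k < 0 → fourierCoeff f k = 0) :
    f =ᵐ[haarAddCircle] fun x => powerSum (fun k => fourierCoeff f (k : ℤ)) (toCircle x) := by
  filter_upwards [coeFn_eq_tsum_fourier hf] with x hx
  rw [hx, powerSum, ← (Nat.cast_injective (R := ℤ)).tsum_eq]
  · congr 1
    ext k
    rw [fourier_apply, toCircle_zsmul, zpow_natCast, Circle.coe_pow]
  · intro k hk
    by_contra hk'
    refine hk ?_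
    dsimp only
    rw [h0 k, zero_mul]
    by_contra hk''
    exact hk' ⟨k.toNat, by omega⟩

lemma coeFn_eq_powerSum_inv {f : CircleL2} (hf : Summable fun k : ℤ => ‖fourierCoeff f k‖)
    (h0 : ∀ k : ℤ, 0 < k → fourierCoeff f k = 0) :
    f =ᵐ[haarAddCircle]
      fun x => powerSum (fun k => fourierCoeff f (-(k : ℤ))) (toCircle x : ℂ)⁻¹ := by
  filter_upwards [coeFn_eq_tsum_fourier hf] with x hx
  have hinj : Function.Injective fun k : ℕ => -(k : ℤ) := fun a b h => by simpa using h
  rw [hx, powerSum, ← hinj.tsum_eq]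
  · congr 1
    ext k
    rw [fourier_apply, toCircle_zsmul, zpow_neg, zpow_natCast, Circle.coe_inv, Circle.coe_pow,
      inv_pow]
  · intro k hk
    by_contra hk'
    refine hk ?_
    dsimp only
    rw [h0 k, zero_mul]
    by_contra hk''
    exact hk' ⟨(-k).toNat, by dsimp only; omega⟩

/-- One row of the vector Riemann–Hilbert problem, in terms of power series. -/
lemma row_identity {μ : ℂ} (hμ : 1 < ‖μ‖) {G : C(UnitAddCircle, ℂ)}
    (hG : ∀ x, ‖G x‖ ≤ 1) (hL : UniformTranslationLipschitz G) {c : ℂ} {U V : CircleL2}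
    (hU : TranslationLipschitz U) (hV : TranslationLipschitz V)
    (hU0 : ∀ k : ℤ, 0 < k → fourierCoeff U k = 0) (hV0 : ∀ k : ℤ, 0 < k → fourierCoeff V k = 0)
    (hUV : U = c • fourierLp 2 0 - μ⁻¹ • projNeg (mulCont G V)) :
    ∃ w : ℕ → ℂ, (Summable fun k => ‖w k‖) ∧ ∀ x : UnitAddCircle,
      powerSum w (toCircle x) =
        μ * powerSum (fun k => fourierCoeff U (-(k : ℤ))) (toCircle x : ℂ)⁻¹ +
        G x * powerSum (fun k => fourierCoeff V (-(k : ℤ))) (toCircle x : ℂ)⁻¹ := by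
  have hμ0 : μ ≠ 0 := by rintro rfl; simp at hμ; linarith
  have hinj : Function.Injective fun k : ℕ => -(k : ℤ) := fun a b h => by simpa using h
  have hUs := hU.summable_norm_fourierCoeff
  have hVs := hV.summable_norm_fourierCoeff
  set W : CircleL2 := μ • U + mulCont G V with hW
  have hWs := ((hU.smul μ).add (hL.translationLipschitz_mulCont hG hV)).summable_norm_fourierCoeff
  -- At negative frequencies the fixed-point equation says `μ U_k = -(G V)_k`.
  have hW0 : ∀ k : ℤ, k < 0 → fourierCoeff W k = 0 := by
    intro k hk
    have h1 := congrArg (fun f : CircleL2 => fourierCoeff f k) hUV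
    simp only [fourierCoeff_sub, fourierCoeff_smul, fourierCoeff_fourierLp, fourierCoeff_projNeg,
      if_pos hk, if_neg hk.ne] at h1
    rw [hW, fourierCoeff_add, fourierCoeff_smul, h1]
    field_simp
    ring
  refine ⟨fun k => fourierCoeff W (k : ℤ), hWs.comp_injective Nat.cast_injective, ?_⟩
  have hz : Continuous fun x : UnitAddCircle => (toCircle x : ℂ) :=
    continuous_subtype_val.comp continuous_toCircle
  have hzi : Continuous fun x : UnitAddCircle => (toCircle x : ℂ)⁻¹ :=
    hz.inv₀ fun x => Circle.coe_ne_zero _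
  have c1 : Continuous fun x : UnitAddCircle =>
      powerSum (fun k => fourierCoeff W (k : ℤ)) (toCircle x) :=
    (continuousOn_powerSum (hWs.comp_injective Nat.cast_injective)).comp_continuous hz
      fun x => (Circle.norm_coe _).le
  have c2 : ∀ f : CircleL2, (Summable fun k : ℤ => ‖fourierCoeff f k‖) →
      Continuous fun x : UnitAddCircle =>
        powerSum (fun k => fourierCoeff f (-(k : ℤ))) (toCircle x : ℂ)⁻¹ := fun f hf =>
    (continuousOn_powerSum (hf.comp_injective hinj)).comp_continuous hzi fun x => by
      rw [Set.mem_ofPred_eq, norm_inv, Circle.norm_coe, inv_one]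
  have hae : (fun x : UnitAddCircle => powerSum (fun k => fourierCoeff W (k : ℤ)) (toCircle x))
      =ᵐ[haarAddCircle] fun x =>
        μ * powerSum (fun k => fourierCoeff U (-(k : ℤ))) (toCircle x : ℂ)⁻¹ +
        G x * powerSum (fun k => fourierCoeff V (-(k : ℤ))) (toCircle x : ℂ)⁻¹ := by
    filter_upwards [coeFn_eq_powerSum hWs hW0, coeFn_eq_powerSum_inv hUs hU0,
      coeFn_eq_powerSum_inv hVs hV0, coeFn_mulCont G V, Lp.coeFn_smul μ U,
      Lp.coeFn_add (μ • U) (mulCont G V)] with x e1 e2 e3 e4 e5 e6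
    rw [← e1, ← e2, ← e3, e6, Pi.add_apply, e5, e4, Pi.smul_apply, smul_eq_mul]
  -- Both sides are continuous, so almost everywhere equality is equality everywhere.
  exact congrFun ((Continuous.ae_eq_iff_eq haarAddCircle c1
    ((continuous_const.mul (c2 U hUs)).add ((map_continuous G).mul (c2 V hVs)))).1 hae)

/-- Solvability of the vector Riemann–Hilbert problem, in terms of power series. -/
theorem exists_powerSum_solution {μ : ℂ} (hμ : 1 < ‖μ‖) {G₁ G₂ : C(UnitAddCircle, ℂ)}
    (h₁ : ∀ x, ‖G₁ x‖ ≤ 1) (h₂ : ∀ x, ‖G₂ x‖ ≤ 1) (hL₁ : UniformTranslationLipschitz G₁)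
    (hL₂ : UniformTranslationLipschitz G₂) (c₁ c₂ : ℂ) :
    ∃ a b u v : ℕ → ℂ, (Summable fun k => ‖a k‖) ∧ (Summable fun k => ‖b k‖) ∧
      (Summable fun k => ‖u k‖) ∧ (Summable fun k => ‖v k‖) ∧ a 0 = c₁ ∧ b 0 = c₂ ∧
      ∀ x : UnitAddCircle,
        powerSum u (toCircle x) =
          μ * powerSum a (toCircle x : ℂ)⁻¹ + G₁ x * powerSum b (toCircle x : ℂ)⁻¹ ∧
        powerSum v (toCircle x) =
          G₂ x * powerSum a (toCircle x : ℂ)⁻¹ + μ * powerSum b (toCircle x : ℂ)⁻¹ := by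
  obtain ⟨V₁, V₂, e₁, e₂⟩ :=
    exists_fixedPoint hμ h₁ h₂ (c₁ • fourierLp 2 0) (c₂ • fourierLp 2 0)
  obtain ⟨l₁, l₂⟩ := translationLipschitz_of_fixedPoint hμ h₁ h₂ hL₁ hL₂ e₁ e₂
  have hcoeff : ∀ {c : ℂ} {F U : CircleL2}, U = c • fourierLp 2 0 - μ⁻¹ • projNeg F →
      ∀ k : ℤ, 0 ≤ k → fourierCoeff U k = if k = 0 then c else 0 := by
    intro c F U hU k hk
    rw [hU, fourierCoeff_sub, fourierCoeff_smul, fourierCoeff_smul, fourierCoeff_fourierLp,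
      fourierCoeff_projNeg, if_neg hk.not_gt]
    simp
  have z₁ : ∀ k : ℤ, 0 < k → fourierCoeff V₁ k = 0 := fun k hk => by
    rw [hcoeff e₁ k hk.le, if_neg hk.ne']
  have z₂ : ∀ k : ℤ, 0 < k → fourierCoeff V₂ k = 0 := fun k hk => by
    rw [hcoeff e₂ k hk.le, if_neg hk.ne']
  obtain ⟨u, hu, hu'⟩ := row_identity hμ h₁ hL₁ l₁ l₂ z₁ z₂ e₁
  -- The second row is the first with the two unknowns exchanged.
  obtain ⟨v, hv, hv'⟩ := row_identity hμ h₂ hL₂ l₂ l₁ z₂ z₁ e₂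
  have hinj : Function.Injective fun k : ℕ => -(k : ℤ) := fun a b h => by simpa using h
  refine ⟨fun k => fourierCoeff V₁ (-(k : ℤ)), fun k => fourierCoeff V₂ (-(k : ℤ)), u, v,
    l₁.summable_norm_fourierCoeff.comp_injective hinj,
    l₂.summable_norm_fourierCoeff.comp_injective hinj, hu, hv, ?_, ?_,
    fun x => ⟨hu' x, (hv' x).trans (add_comm _ _)⟩⟩
  · simpa using hcoeff e₁ 0 le_rfl
  · simpa using hcoeff e₂ 0 le_rfl

/-! ### Regularity of the symbol and the condition on `β` -/

/-- A continuous unimodular square root of a Lipschitz function is Lipschitz at small scales. -/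
lemma uniformTranslationLipschitz_of_sq {G : C(UnitAddCircle, ℂ)} (hG : ∀ x, ‖G x‖ = 1)
    {R : ℝ → ℂ} (hR : ContDiff ℝ 1 R) (hsq : ∀ t : ℝ, G (t : UnitAddCircle) ^ 2 = R t) :
    UniformTranslationLipschitz G := by
  -- The interval `[0, 2]` contains `t` and `t + h` for `t ∈ [0, 1)` and `h < 1`.
  obtain ⟨K, hK⟩ := (hR.locallyLipschitz.locallyLipschitzOn
    (s := Set.Icc (0 : ℝ) 2)).exists_lipschitzOnWith_of_compact isCompact_Icc
  -- At this scale `G` moves by less than 1, so the branch cannot change sign: `|G(x+h) + G(x)| ≥ 2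
  -- - 1`, and one may divide `R(t+h) - R(t)` by this sum.
  obtain ⟨δ, hδ, hu⟩ := Metric.uniformContinuous_iff.1
    (CompactSpace.uniformContinuous_of_continuous (map_continuous G)) 1 one_pos
  refine ⟨K, min δ 1, lt_min hδ one_pos, fun h h0 hh x => ?_⟩
  obtain ⟨t, ht, rfl⟩ : ∃ t ∈ Set.Ico (0 : ℝ) (0 + 1), (t : UnitAddCircle) = x := by
    have := AddCircle.coe_image_Ico_eq (1 : ℝ) 0
    exact (this ▸ Set.mem_univ x : x ∈ ((↑) : ℝ → UnitAddCircle) '' Set.Ico (0 : ℝ) (0 + 1))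
  have hh1 : h < 1 := hh.trans_le (min_le_right _ _)
  have hd : dist ((t : UnitAddCircle) + (h : UnitAddCircle)) t < δ := by
    rw [dist_eq_norm, add_sub_cancel_left]
    refine (QuotientAddGroup.norm_mk_le_norm (m := h)).trans_lt ?_
    rw [Real.norm_eq_abs, abs_of_pos h0]
    exact hh.trans_le (min_le_left _ _)
  have h1 := hu hd
  rw [dist_eq_norm] at h1
  have h2 : ‖G ((t : UnitAddCircle) + h) - G t‖ * ‖G ((t : UnitAddCircle) + h) + G t‖ ≤ K * h := by
    rw [← norm_mul]
    have e : (G ((t : UnitAddCircle) + h) - G t) * (G ((t : UnitAddCircle) + h) + G t) =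
        R (t + h) - R t := by
      rw [← hsq, ← hsq, AddCircle.coe_add]
      ring
    have h3 := hK.dist_le_mul (t + h) ⟨by linarith [ht.1], by linarith [ht.2]⟩ t
      ⟨ht.1, by linarith [ht.2]⟩
    rw [dist_eq_norm, dist_eq_norm, add_sub_cancel_left, Real.norm_eq_abs, abs_of_pos h0] at h3
    rwa [e]
  have h4 : 1 ≤ ‖G ((t : UnitAddCircle) + h) + G t‖ := by
    have e : (2 : ℂ) * G t =
        (G ((t : UnitAddCircle) + h) + G t) - (G ((t : UnitAddCircle) + h) - G t) := by ring
    have h5 := norm_sub_le (G ((t : UnitAddCircle) + h) + G t) (G ((t : UnitAddCircle) + h) - G t)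
    rw [← e, norm_mul, hG] at h5
    norm_num at h5
    linarith
  exact (le_mul_of_one_le_right (norm_nonneg _) h4).trans h2

lemma UniformTranslationLipschitz.neg_inv {G H : C(UnitAddCircle, ℂ)} (hG : ∀ x, ‖G x‖ = 1)
    (hH : ∀ x, H x = -(G x)⁻¹) (hL : UniformTranslationLipschitz G) :
    UniformTranslationLipschitz H := by
  obtain ⟨C, δ, hδ, hC⟩ := hL
  refine ⟨C, δ, hδ, fun h h0 hh x => ?_⟩
  have hne : ∀ y, G y ≠ 0 := fun y => norm_ne_zero_iff.1 (by rw [hG]; exact one_ne_zero)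
  have e : H (x + h) - H x = (G (x + h) - G x) * ((G (x + h))⁻¹ * (G x)⁻¹) := by
    rw [hH, hH]
    field_simp [hne x, hne (x + h)]
    ring
  rw [e, norm_mul, norm_mul, norm_inv, norm_inv, hG, hG, inv_one, mul_one, mul_one]
  exact hC h h0 hh x

end CircleL2

lemma IsSymbolBranch.norm_eq_one {n : ℕ} {p : Polynomial ℝ} {g : ℂ → ℂ}
    (hg : IsSymbolBranch n p g) (hroots : ∀ z : ℂ, ‖z‖ = 1 → Polynomial.aeval z p ≠ 0)
    {z : ℂ} (hz : ‖z‖ = 1) : ‖g z‖ = 1 := by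
  have h1 := congrArg norm (hg.sq_eq z hz)
  have hconj : Polynomial.aeval (1 / z) p = (starRingEnd ℂ) (Polynomial.aeval z p) := by
    rw [one_div, Complex.inv_eq_conj hz, Polynomial.aeval_conj]
  rw [norm_pow, norm_div, norm_mul, norm_pow, hz, one_pow, one_mul, hconj, RCLike.norm_conj,
    div_self (norm_ne_zero_iff.2 (hroots z hz))] at h1
  exact (pow_eq_one_iff_of_nonneg (norm_nonneg _) two_ne_zero).1 h1

lemma contDiff_symbol_sq (n : ℕ) (p : Polynomial ℝ)
    (hroots : ∀ z : ℂ, ‖z‖ = 1 → Polynomial.aeval z p ≠ 0) :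
    ContDiff ℝ 1 fun t : ℝ =>
      Polynomial.aeval (exp (2 * Real.pi * t * I)) p /
        (exp (2 * Real.pi * t * I) ^ (2 * n) *
          Polynomial.aeval (1 / exp (2 * Real.pi * t * I)) p) := by
  have hp : ContDiff ℝ 1 fun z : ℂ => Polynomial.aeval z p := by
    simpa only [Polynomial.aeval_map_algebraMap] using
      (Polynomial.contDiff_aeval (𝕜 := ℂ) (p.map (algebraMap ℝ ℂ)) 1).restrict_scalars ℝ
  have he : ContDiff ℝ 1 fun t : ℝ => exp (2 * Real.pi * t * I) := by
    have : ContDiff ℝ 1 fun t : ℝ => (t : ℂ) := Complex.ofRealCLM.contDiff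
    exact Complex.contDiff_exp.comp ((contDiff_const.mul this).mul contDiff_const)
  have hne : ∀ t : ℝ, exp (2 * Real.pi * t * I) ≠ 0 := fun t => exp_ne_zero _
  simp only [div_eq_mul_inv, one_mul]
  refine (hp.comp he).mul (((he.pow _).mul (hp.comp (he.inv hne))).inv fun t => ?_)
  refine mul_ne_zero (pow_ne_zero _ (hne t)) (hroots _ ?_)
  have e : (2 * Real.pi * t * I : ℂ) = ((2 * Real.pi * t : ℝ) : ℂ) * I := by push_cast; ring
  rw [Pi.inv_apply, norm_inv, e, Complex.norm_exp_ofReal_mul_I, inv_one]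

/-- Imaginary `β` means that `w = (λ+1)/(λ-1)` has argument 0, so `w > 0`. Then `λ (w - 1) = w + 1`
with `|w - 1| < w + 1`. -/
lemma one_lt_norm_of_beta_re_eq_zero {lam : ℂ} (h_one : lam ≠ 1) (h_neg_one : lam ≠ -1)
    (hbeta : (beta lam).re = 0) : 1 < ‖lam‖ := by
  set w : ℂ := (lam + 1) / (lam - 1) with hw
  have hsub : lam - 1 ≠ 0 := sub_ne_zero.2 h_one
  have harg : w.arg = 0 := by
    have e : beta lam = ((2 * Real.pi)⁻¹ : ℝ) * (-I * Complex.log w) := by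
      rw [beta, ← hw]
      push_cast
      field_simp
      rw [I_sq]
      ring
    rw [e, Complex.re_ofReal_mul, mul_eq_zero] at hbeta
    have h1 := hbeta.resolve_left (by positivity)
    simpa [Complex.log_im] using h1
  obtain ⟨hre, him⟩ := Complex.arg_eq_zero_iff.1 harg
  have hwre : w = (w.re : ℂ) := Complex.ext rfl (by simpa using him)
  have hw0 : w ≠ 0 := div_ne_zero (fun h => h_neg_one (eq_neg_of_add_eq_zero_left h)) hsub
  have hpos : 0 < w.re := lt_of_le_of_ne hre fun h => hw0 (by rw [hwre, ← h, ofReal_zero])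
  have h1 : lam * ((w.re - 1 : ℝ) : ℂ) = ((w.re + 1 : ℝ) : ℂ) := by
    push_cast
    rw [← hwre, hw]
    field_simp
    ring
  have h2 := congrArg norm h1
  rw [norm_mul, Complex.norm_real, Complex.norm_real, Real.norm_eq_abs, Real.norm_eq_abs,
    abs_of_pos (by linarith : 0 < w.re + 1)] at h2
  have h3 : |w.re - 1| < w.re + 1 := abs_lt.2 ⟨by linarith, by linarith⟩
  by_contra! hle
  have := mul_le_of_le_one_left (abs_nonneg (w.re - 1)) hle
  linarith

end

/-! ### Assembly of the matrix solution -/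

theorem mainTheorem8 (n : ℕ) (p : Polynomial ℝ) (hdeg : p.natDegree = 2 * n)
    (hroots : ∀ z : ℂ, ‖z‖ = 1 → Polynomial.aeval z p ≠ 0)
    (g : ℂ → ℂ) (hg : IsSymbolBranch n p g)
    (lam : ℂ) (h_one : lam ≠ 1) (h_neg_one : lam ≠ -1)
    (hbeta : (beta lam).re = 0) :
    ∃ Tp Tm : ℂ → Matrix (Fin 2) (Fin 2) ℂ, IsRHSolution (Phi lam g) Tp Tm := by
  have hlam : 1 < ‖I * lam‖ := by
    rw [norm_mul, norm_I, one_mul]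
    exact one_lt_norm_of_beta_re_eq_zero h_one h_neg_one hbeta
  have hgc : Continuous fun x : UnitAddCircle => g (AddCircle.toCircle x) :=
    hg.continuousOn.comp_continuous
      (continuous_subtype_val.comp AddCircle.continuous_toCircle) fun x => Circle.norm_coe _
  have hg1 : ∀ x : UnitAddCircle, ‖g (AddCircle.toCircle x)‖ = 1 :=
    fun x => hg.norm_eq_one hroots (Circle.norm_coe _)
  let G : C(UnitAddCircle, ℂ) := ⟨fun x => g (AddCircle.toCircle x), hgc⟩
  let H : C(UnitAddCircle, ℂ) := ⟨fun x => -(g (AddCircle.toCircle x))⁻¹,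
    (hgc.inv₀ fun x => norm_ne_zero_iff.1 (by rw [hg1]; exact one_ne_zero)).neg⟩
  have hH1 : ∀ x, ‖H x‖ = 1 := fun x => by
    change ‖-(g (AddCircle.toCircle x))⁻¹‖ = 1
    rw [norm_neg, norm_inv, hg1, inv_one]
  have hGL : CircleL2.UniformTranslationLipschitz G := by
    refine CircleL2.uniformTranslationLipschitz_of_sq hg1 (contDiff_symbol_sq n p hroots)
      fun t => ?_
    have e : exp (2 * Real.pi * t * I) = AddCircle.toCircle (t : UnitAddCircle) := by
      rw [AddCircle.toCircle_apply_mk, Circle.coe_exp]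
      push_cast
      rw [div_one]
    rw [e]
    exact hg.sq_eq _ (Circle.norm_coe _)
  have hHL : CircleL2.UniformTranslationLipschitz H := hGL.neg_inv hg1 fun x => rfl
  have hsol := CircleL2.exists_powerSum_solution hlam (fun x => (hg1 x).le)
    (fun x => (hH1 x).le) hGL hHL
  -- The two columns of `T₋` take the values `(1, 0)` and `(0, 1)` at infinity.
  obtain ⟨a₁, b₁, u₁, v₁, ha₁, hb₁, hu₁, hv₁, ha₁0, hb₁0, hj₁⟩ := hsol 1 0
  obtain ⟨a₂, b₂, u₂, v₂, ha₂, hb₂, hu₂, hv₂, ha₂0, hb₂0, hj₂⟩ := hsol 0 1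
  let P : Matrix (Fin 2) (Fin 2) (ℕ → ℂ) := !![u₁, u₂; v₁, v₂]
  let Q : Matrix (Fin 2) (Fin 2) (ℕ → ℂ) := !![a₁, a₂; b₁, b₂]
  have hP : ∀ i j, Summable fun k => ‖P i j k‖ := by
    intro i j
    fin_cases i <;> fin_cases j
    exacts [hu₁, hu₂, hv₁, hv₂]
  have hQ : ∀ i j, Summable fun k => ‖Q i j k‖ := by
    intro i j
    fin_cases i <;> fin_cases j
    exacts [ha₁, ha₂, hb₁, hb₂]
  have hQ0 : ∀ i j, Q i j 0 = (1 : Matrix (Fin 2) (Fin 2) ℂ) i j := by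
    intro i j
    fin_cases i <;> fin_cases j
    exacts [ha₁0, ha₂0, hb₁0, hb₂0]
  refine ⟨fun z => Matrix.of fun i j => powerSum (P i j) z,
    fun z => Matrix.of fun i j => powerSum (Q i j) z⁻¹, ?_, ?_, ?_, ?_, ?_, ?_⟩
  · exact fun i j => differentiableOn_powerSum (hP i j)
  · intro i j
    refine (differentiableOn_powerSum (hQ i j)).comp (t := {z | ‖z‖ < 1})
      (fun z (hz : 1 < ‖z‖) => ?_) fun z (hz : 1 < ‖z‖) => ?_
    · exact (differentiableAt_inv (norm_pos_iff.1 (one_pos.trans hz))).differentiableWithinAt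
    · change ‖z⁻¹‖ < 1
      rw [norm_inv]
      exact inv_lt_one_of_one_lt₀ hz
  · exact continuousOn_pi.2 fun i => continuousOn_pi.2 fun j => continuousOn_powerSum (hP i j)
  · refine continuousOn_pi.2 fun i => continuousOn_pi.2 fun j => ?_
    refine (continuousOn_powerSum (hQ i j)).comp (t := {z | ‖z‖ ≤ 1})
      (fun z (hz : 1 ≤ ‖z‖) => ?_) fun z (hz : 1 ≤ ‖z‖) => ?_
    · exact (continuousAt_inv₀ (norm_pos_iff.1 (one_pos.trans_le hz))).continuousWithinAt
    · change ‖z⁻¹‖ ≤ 1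
      rw [norm_inv]
      exact inv_le_one_of_one_le₀ hz
  · intro z hz
    obtain ⟨x, hx⟩ := (AddCircle.homeomorphCircle (one_ne_zero : (1 : ℝ) ≠ 0)).surjective
      ⟨z, mem_sphere_zero_iff_norm.2 hz⟩
    have hxz : (AddCircle.toCircle x : ℂ) = z := by
      rw [AddCircle.homeomorphCircle_apply] at hx
      exact congrArg Subtype.val hx
    have e₁ := hj₁ x
    have e₂ := hj₂ x
    simp only [G, H, ContinuousMap.coe_mk, hxz] at e₁ e₂
    ext i j
    fin_cases i <;> fin_cases j <;>
      simp [P, Q, Phi, Matrix.mul_apply, Fin.sum_univ_two, e₁, e₂]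
  · refine tendsto_pi_nhds.2 fun i => tendsto_pi_nhds.2 fun j => ?_
    have hcont : ContinuousAt (powerSum (Q i j)) 0 :=
      (continuousOn_powerSum (hQ i j)).continuousAt
        (by
          simpa [Metric.closedBall, dist_zero_right] using
            Metric.closedBall_mem_nhds (0 : ℂ) one_pos)
    -- Inversion turns the limit at infinity into the constant term of the power series.
    have h1 := hcont.tendsto.comp tendsto_inv₀_cobounded
    rw [powerSum_zero, hQ0, Metric.cobounded_eq_cocompact] at h1
    exact h1
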